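/- Let $V$ be a complex Hilbert space, let $V'$ be its anti-dual (the bounded antilinear functionals on $V$), and let $\langle v,\ell\rangle=\ell(v)$ denote the anti-duality between $V$ and $V'$, antilinear in $v$ and linear in $\ell$. Let $\sigma,M,\mu\in\mathbb{R}$ and $\alpha\ge 0$. Let $L(s):V\to V'$ and $R(s):V\to V$ be families of bounded linear operators that are analytic for $\mathrm{Re}\,s>\sigma$ and continuous for $\mathrm{Re}\,s\ge\sigma$ (in the operator norm), with $$\|L(s)\|\le M(1+|s|)^\mu,\qquad \|R(s)\|\le M(1+|s|)^\mu\qquad\text{for }\mathrm{Re}\,s>\sigma,$$ and suppose that $$\mathrm{Re}\,\langle v,L(s)v\rangle\ge\alpha\|R(s)v\|^2\qquad\text{for all }v\in V,\ \mathrm{Re}\,s\ge\sigma.$$ Let $(\cdot,\cdot)$ be any inner product on $\mathbb{C}^m$ (antilinear in the first argument) with norm $|\cdot|$, and equip $V^m=\mathbb{C}^m\otimes V$ with the induced inner product $(a\otimes u,b\otimes v)=(a,b)(u,v)$, its norm $\|\cdot\|$, and the induced anti-duality $\langle a\otimes u,b\otimes\ell\rangle=(a,b)\langle u,\ell\rangle$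 between $V^m$ and $(V')^m$, both extended sesquilinearly. Let $S\in\mathbb{C}^{m\times m}$ satisfy $$\mathrm{Re}\,(w,Sw)\ge\sigma|w|^2\qquad\text{for all }w\in\mathbb{C}^m.$$ For $f=L$ or $f=R$ let $$f(S)=\sum_{\lambda}\sum_{k=0}^{m-1}\frac{1}{k!}\,(S-\lambda I)^kP_\lambda\otimes f^{(k)}(\lambda)$$ denote the usual (Jordan form) matrix function, where $\lambda$ runs over the distinct eigenvalues of $S$ and $P_\lambda$ is the projection onto the generalised eigenspace of $\lambda$ along the sum of the other generalised eigenspaces. (All eigenvalues of $S$ satisfy $\mathrm{Re}\,\lambda\ge\sigma$, and those with $\mathrm{Re}\,\lambda=\sigma$ are semisimple, so that $(S-\lambda I)P_\lambda=0$; there the terms with $k\ge1$ are taken to be zero and only the value $f(\lambda)$ enters.) Then $$\mathrm{Re}\,\langle \mathbf{v},L(S)\mathbf{v}\rangle\ge\alpha\|R(S)\mathbf{v}\|^2\qquad\text{for all }\mathbf{v}\in V^m.$$ -/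

import Mathlib

/-- The spectral projection of a complex square matrix `S` at `z`: the projection onto the
generalised eigenspace `⋃ₙ ker (S - z)ⁿ` along its `S`-invariant complement
`⋂ₙ range (S - z)ⁿ`, which is the sum of the other generalised eigenspaces. -/
noncomputable def spectralProjection {m : ℕ} (S : Matrix (Fin m) (Fin m) ℂ) (z : ℂ) :
    Matrix (Fin m) (Fin m) ℂ :=
  LinearMap.toMatrix' (Submodule.projection _ _
    (LinearMap.isCompl_iSup_ker_pow_iInf_range_pow
      (Matrix.toLin' (S - Matrix.scalar (Fin m) z))))

/-- The matrix function `f(S) : E^m → F^m` of an operator family `f(s) : E → F`,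
`f(S) = ∑_z ∑_{k < m} (1/k!) (S - z)^k P_z ⊗ f^(k)(z)`,
where `z` ranges over the distinct eigenvalues of `S` and `P_z` is the spectral projection.
This is the usual primary matrix function (Jordan form definition).  At an eigenvalue `z` that is
semisimple one has `(S - z) P_z = 0`, so that only the value `f(z)` enters there and no
differentiability of `f` at `z` is involved. -/
noncomputable def matrixFunction {E F : Type*} [NormedAddCommGroup E] [NormedSpace ℂ E]
    [NormedAddCommGroup F] [NormedSpace ℂ F] {m : ℕ}
    (f : ℂ → E →L[ℂ] F) (S : Matrix (Fin m) (Fin m) ℂ) (v : Fin m → E) : Fin m → F :=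
  fun i => ∑ z ∈ S.charpoly.roots.toFinset, ∑ k ∈ Finset.range m, ∑ j,
    ((k.factorial : ℂ)⁻¹ * ((S - Matrix.scalar (Fin m) z) ^ k * spectralProjection S z) i j) •
      iteratedDeriv k f z (v j)

/-- The anti-dual `V'` of a complex Hilbert space: bounded antilinear functionals. The anti-duality
`⟨v, l⟩ = l v` is antilinear in `v` and linear in `l`. -/
abbrev AntiDual (V : Type*) [NormedAddCommGroup V] [InnerProductSpace ℂ V] : Type _ :=
  V →L⋆[ℂ] ℂ

/-- The anti-duality between `V^m` and `(V')^m` induced by an inner product `(·,·)` on `ℂ^m`: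
the sesquilinear extension of `⟨a ⊗ u, b ⊗ l⟩ = (a, b) ⟨u, l⟩`. -/
noncomputable def blockPairing {V : Type*} [NormedAddCommGroup V] [InnerProductSpace ℂ V] {m : ℕ}
    (ip : InnerProductSpace.Core ℂ (Fin m → ℂ)) (v : Fin m → V) (l : Fin m → AntiDual V) : ℂ :=
  ∑ i, ∑ j, ip.inner (Pi.single i 1) (Pi.single j 1) * l j (v i)

/-- The inner product on `V^m` induced by an inner product `(·,·)` on `ℂ^m`: the sesquilinear
extension of `(a ⊗ u, b ⊗ v) = (a, b) (u, v)`. -/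
noncomputable def blockInner {V : Type*} [NormedAddCommGroup V] [InnerProductSpace ℂ V] {m : ℕ}
    (ip : InnerProductSpace.Core ℂ (Fin m → ℂ)) (u v : Fin m → V) : ℂ :=
  ∑ i, ∑ j, ip.inner (Pi.single i 1) (Pi.single j 1) * inner ℂ (u i) (v j)

/-- The norm on `V^m` that belongs to `blockInner`. -/
noncomputable def blockNorm {V : Type*} [NormedAddCommGroup V] [InnerProductSpace ℂ V] {m : ℕ}
    (ip : InnerProductSpace.Core ℂ (Fin m → ℂ)) (v : Fin m → V) : ℝ :=
  Real.sqrt (blockInner ip v v).re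

open scoped ComplexOrder Topology

/-! The inequality comes from writing `f(S)` as an average of `f` against a positive matrix kernel.
Let `G` be the Gram matrix of the inner product on `ℂ^m`, and suppose first that `S - c` has norm
less than `ρ` and that `L`, `R` are analytic and coercive on the closed disc of centre `c` and
radius `ρ`. Then `D = ρ² G - (S - c)ᴴ G (S - c)` is positive definite, and so is `K(z) = (z - S)⁻ᴴ D
(z - S)⁻¹` on the circle. There `K(z) = (z - c) G (z - S)⁻¹ + (conj (z - c) (z - S)⁻ᴴ - 1) G`
(`discKernel_eq`). The first term averages against `f` to `G f(S)` by Cauchy's formula. The second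
is the boundary value of a holomorphic function vanishing at `c` and averages to zero
(`AnalyticOnNhd.circleAverage_discKernel_mul`).

Since `‖R(z)v‖²` is not holomorphic in `z`, it is replaced by a lower bound affine in `R(z)`: for
fixed `w`, `Re ⟨v, L(z)v⟩ - 2α Re (w, R(z)v) + α‖w‖² ≥ α‖w - R(z)v‖² ≥ 0`. This survives tensoring
with `K(z) ≥ 0` (`Matrix.PosSemidef.coercivity`). Averaging with `w = R(S)v` leaves `Re ⟨v, L(S)v⟩ -
2α‖w‖² + α‖w‖² ≥ 0` (`coercivity_of_posDef_defectMatrix`).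

In general `S` lies in this sense in a large disc inside `{Re s > σ - ε}`
(`exists_posDef_defectMatrix`), so the disc case applies to `L(· + ε)` and `R(· + ε)`. Letting `ε →
0` gives the theorem (`tendsto_matrixFunction_comp_add`): eigenvalues with `Re z = σ` are
semisimple, so continuity of `f` suffices there. -/

/-- The generalised eigenspace of `A` at `z` lies in the range of every power of `A - w`,
for `w ≠ z`. -/
lemma Module.End.maxGenEigenspace_le_iInf_range_pow {K V : Type*} [Field K] [AddCommGroup V]
    [Module K V] [FiniteDimensional K V] (A : Module.End K V) {z w : K} (h : w ≠ z) :
    A.maxGenEigenspace z ≤ ⨅ n, LinearMap.range ((A - w • (1 : Module.End K V)) ^ n) := by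
  rw [le_iInf_iff]
  intro n
  set B := A - w • (1 : Module.End K V) with hB
  have hmaps : Set.MapsTo B (A.maxGenEigenspace z) (A.maxGenEigenspace z) :=
    Module.End.mapsTo_maxGenEigenspace_of_comm
      ((Commute.refl A).sub_right ((Commute.one_right A).smul_right w)) z
  -- Generalised eigenspaces at distinct points are disjoint, so `B` is injective on this one; by
  -- finite dimension it is onto, and so are its iterates.
  have hinj : Function.Injective (B.restrict hmaps) := by
    rw [injective_iff_map_eq_zero]
    rintro ⟨x, hx⟩ h0
    have h1 : B x = 0 := congrArg Subtype.val h0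
    have h2 : x ∈ A.maxGenEigenspace w := by
      rw [Module.End.mem_maxGenEigenspace]
      exact ⟨1, by rw [pow_one]; exact h1⟩
    have := (A.independent_maxGenEigenspace.pairwiseDisjoint h).le_bot ⟨h2, hx⟩
    exact Subtype.ext (by simpa using this)
  have hsemi : Function.Semiconj Subtype.val (B.restrict hmaps) B := fun _ => rfl
  intro x hx
  obtain ⟨y, hy⟩ := (LinearMap.surjective_of_injective hinj).iterate n ⟨x, hx⟩
  exact ⟨y, by rw [Module.End.coe_pow, ← hsemi.iterate_right n y, hy]⟩

/-! ### Spectral projections and the partial fractions of the resolvent -/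

section SpectralProjection

variable {m : ℕ} (S : Matrix (Fin m) (Fin m) ℂ) (z : ℂ)

lemma toLin'_sub_scalar : Matrix.toLin' (S - Matrix.scalar (Fin m) z)
    = Matrix.toLin' S - z • (1 : Module.End ℂ (Fin m → ℂ)) := by
  ext i j
  simp [Matrix.scalar_apply, Pi.single_apply]

lemma iSup_ker_pow_eq_maxGenEigenspace :
    ⨆ n, LinearMap.ker (Matrix.toLin' (S - Matrix.scalar (Fin m) z) ^ n)
      = Module.End.maxGenEigenspace (Matrix.toLin' S) z := by
  rw [← Module.End.iSup_genEigenspace_eq, toLin'_sub_scalar]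
  simp [Module.End.genEigenspace_nat]

lemma spectralProjection_mulVec_mem (w : Fin m → ℂ) :
    (spectralProjection S z).mulVec w ∈ Module.End.maxGenEigenspace (Matrix.toLin' S) z := by
  rw [← iSup_ker_pow_eq_maxGenEigenspace, ← Matrix.toLin'_apply, spectralProjection,
    Matrix.toLin'_toMatrix']
  exact Submodule.projection_apply_mem _ _

lemma spectralProjection_mulVec_of_mem {w : Fin m → ℂ}
    (hw : w ∈ Module.End.maxGenEigenspace (Matrix.toLin' S) z) :
    (spectralProjection S z).mulVec w = w := by
  rw [← iSup_ker_pow_eq_maxGenEigenspace] at hw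
  rw [← Matrix.toLin'_apply, spectralProjection, Matrix.toLin'_toMatrix']
  exact Submodule.projection_apply_of_mem_left _ hw

lemma spectralProjection_mulVec_of_mem_of_ne {w : Fin m → ℂ} {y : ℂ} (h : z ≠ y)
    (hw : w ∈ Module.End.maxGenEigenspace (Matrix.toLin' S) y) :
    (spectralProjection S z).mulVec w = 0 := by
  rw [← Matrix.toLin'_apply, spectralProjection, Matrix.toLin'_toMatrix',
    Submodule.projection_apply_eq_zero_iff, toLin'_sub_scalar]
  exact Module.End.maxGenEigenspace_le_iInf_range_pow _ h hw

/-- In dimension `m` the kernels of the powers of `S - z` are stationary from exponent `m` on. This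
is why the orders `k < m` suffice in `matrixFunction`. -/
lemma sub_scalar_pow_mul_spectralProjection :
    (S - Matrix.scalar (Fin m) z) ^ m * spectralProjection S z = 0 := by
  rw [← Matrix.toLin'.map_eq_zero_iff]
  refine LinearMap.ext fun w => ?_
  have h := spectralProjection_mulVec_mem S z w
  rw [Module.End.maxGenEigenspace_eq_genEigenspace_finrank, Module.finrank_fin_fun,
    Module.End.mem_genEigenspace_nat, ← toLin'_sub_scalar, LinearMap.mem_ker, ← Matrix.toLin'_pow,
    Matrix.toLin'_apply, Matrix.mulVec_mulVec] at h
  rw [Matrix.toLin'_apply, h, LinearMap.zero_apply]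

lemma mem_charpoly_roots_toFinset :
    z ∈ S.charpoly.roots.toFinset ↔ Module.End.HasEigenvalue (Matrix.toLin' S) z := by
  rw [Multiset.mem_toFinset, Polynomial.mem_roots S.charpoly_monic.ne_zero,
    Module.End.hasEigenvalue_iff_isRoot_charpoly, Matrix.charpoly_toLin']

/-- The spectral projections form a resolution of the identity. -/
lemma sum_spectralProjection :
    ∑ z ∈ S.charpoly.roots.toFinset, spectralProjection S z = 1 := by
  have key : ∀ w : Fin m → ℂ, w ∈ (⊤ : Submodule ℂ (Fin m → ℂ)) →
      (∑ z ∈ S.charpoly.roots.toFinset, spectralProjection S z).mulVec w = w := by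
    intro w hw
    rw [← Module.End.iSup_maxGenEigenspace_eq_top (Matrix.toLin' S)] at hw
    induction hw using Submodule.iSup_induction' with
    | zero => simp
    | add x y _ _ hx hy => rw [Matrix.mulVec_add, hx, hy]
    | mem y w hw =>
      rw [Matrix.sum_mulVec]
      by_cases hy : y ∈ S.charpoly.roots.toFinset
      · rw [Finset.sum_eq_single y, spectralProjection_mulVec_of_mem S y hw]
        · exact fun z _ hz => spectralProjection_mulVec_of_mem_of_ne S z hz hw
        · exact fun h => absurd hy h
      · have h0 : w = 0 := by
          by_contra hne
          refine hy ((mem_charpoly_roots_toFinset S y).2 ?_)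
          refine Module.End.hasEigenvalue_iff.2 fun hbot => hne ?_
          rw [Module.End.mem_maxGenEigenspace] at hw
          obtain ⟨k, hk⟩ := hw
          have hinj : Function.Injective ⇑(Matrix.toLin' S - y • (1 : Module.End ℂ (Fin m → ℂ))) := by
            rw [← LinearMap.ker_eq_bot, ← Module.End.eigenspace_def]
            exact hbot
          rw [Module.End.coe_pow] at hk
          exact hinj.iterate k (by rw [hk, iterate_map_zero])
        simp [h0]
  refine Matrix.toLin'.injective (LinearMap.ext fun w => ?_)
  rw [Matrix.toLin'_apply, key w trivial]
  simp

/-- The principal part of the resolvent at the eigenvalues: `(y - S)⁻¹` is the sum of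
`(y - z)⁻ᵏ⁻¹ (S - z)ᵏ P_z`. -/
lemma scalar_sub_mul_sum_resolvent {y : ℂ} (hy : y ∉ S.charpoly.roots.toFinset) :
    (Matrix.scalar (Fin m) y - S) * (∑ z ∈ S.charpoly.roots.toFinset, ∑ k ∈ Finset.range m,
      ((y - z)⁻¹ ^ (k + 1)) • ((S - Matrix.scalar (Fin m) z) ^ k * spectralProjection S z)) = 1 := by
  rw [← sum_spectralProjection S, Finset.mul_sum]
  refine Finset.sum_congr rfl fun z hz => ?_
  have hyz : y - z ≠ 0 := fun h => hy (by rwa [sub_eq_zero.1 h])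
  set N := S - Matrix.scalar (Fin m) z with hN
  have hS : Matrix.scalar (Fin m) y - S = (y - z) • (1 : Matrix (Fin m) (Fin m) ℂ) - N := by
    ext i j
    simp only [hN, Matrix.sub_apply, Matrix.smul_apply, Matrix.scalar_apply, Matrix.diagonal_apply,
      Matrix.one_apply, smul_eq_mul]
    split_ifs <;> ring
  -- Since `y - S = (y - z) - N`, the sum over `k` telescopes to `P_z - (y - z)⁻ᵐ Nᵐ P_z`, and `Nᵐ
  -- P_z = 0`.
  have hk : ∀ k ∈ Finset.range m, (Matrix.scalar (Fin m) y - S) *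
      (((y - z)⁻¹ ^ (k + 1)) • (N ^ k * spectralProjection S z))
      = ((y - z)⁻¹ ^ k) • (N ^ k * spectralProjection S z)
        - ((y - z)⁻¹ ^ (k + 1)) • (N ^ (k + 1) * spectralProjection S z) := by
    intro k _
    rw [hS, sub_mul, smul_mul_smul_comm, one_mul, Matrix.mul_smul, ← mul_assoc N, ← pow_succ']
    congr 2
    rw [pow_succ]
    field_simp
  rw [Finset.mul_sum, Finset.sum_congr rfl hk, Finset.sum_range_sub',
    sub_scalar_pow_mul_spectralProjection]
  simp

lemma inv_scalar_sub {y : ℂ} (hy : y ∉ S.charpoly.roots.toFinset) :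
    (Matrix.scalar (Fin m) y - S)⁻¹ = ∑ z ∈ S.charpoly.roots.toFinset, ∑ k ∈ Finset.range m,
      ((y - z)⁻¹ ^ (k + 1)) • ((S - Matrix.scalar (Fin m) z) ^ k * spectralProjection S z) :=
  Matrix.inv_eq_right_inv (scalar_sub_mul_sum_resolvent S hy)

lemma isUnit_scalar_sub {y : ℂ} (hy : y ∉ S.charpoly.roots.toFinset) :
    IsUnit (Matrix.scalar (Fin m) y - S) :=
  IsUnit.of_mul_eq_one _ (scalar_sub_mul_sum_resolvent S hy)

/-- At a semisimple eigenvalue the nilpotent part vanishes. -/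
lemma sub_scalar_mul_spectralProjection_of_semisimple
    (h : ∀ w : Fin m → ℂ, (S - Matrix.scalar (Fin m) z).mulVec
      ((S - Matrix.scalar (Fin m) z).mulVec w) = 0 → (S - Matrix.scalar (Fin m) z).mulVec w = 0) :
    (S - Matrix.scalar (Fin m) z) * spectralProjection S z = 0 := by
  rw [← Matrix.toLin'.map_eq_zero_iff]
  refine LinearMap.ext fun w => ?_
  have hw := spectralProjection_mulVec_mem S z w
  rw [Module.End.mem_maxGenEigenspace, ← toLin'_sub_scalar] at hw
  obtain ⟨k, hk⟩ := hw
  have key : ∀ (k : ℕ) (x : Fin m → ℂ),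
      (Matrix.toLin' (S - Matrix.scalar (Fin m) z) ^ k) x = 0 →
      (S - Matrix.scalar (Fin m) z).mulVec x = 0 := by
    intro k
    induction k with
    | zero => intro x hx; simp only [pow_zero, Module.End.one_apply] at hx; simp [hx]
    | succ k ih =>
      intro x hx
      rw [pow_succ, Module.End.mul_apply] at hx
      exact h x (ih _ hx)
  rw [Matrix.toLin'_apply, ← Matrix.mulVec_mulVec, key k _ hk, LinearMap.zero_apply]

end SpectralProjection

/-! ### Cauchy's formula for scalar matrix functions -/

/-- The entry `i j` of the matrix function `f(S)` of a scalar function `f`. -/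
noncomputable def matrixFunctionEntry {m : ℕ} (f : ℂ → ℂ) (S : Matrix (Fin m) (Fin m) ℂ)
    (i j : Fin m) : ℂ :=
  ∑ z ∈ S.charpoly.roots.toFinset, ∑ k ∈ Finset.range m,
    ((k.factorial : ℂ)⁻¹ * ((S - Matrix.scalar (Fin m) z) ^ k * spectralProjection S z) i j) *
      iteratedDeriv k f z

lemma hasDerivAt_inv_sub_pow {z w : ℂ} (h : z ≠ w) (k : ℕ) :
    HasDerivAt (fun z => (z - w)⁻¹ ^ (k + 1)) (-((k + 1 : ℂ) * (z - w)⁻¹ ^ (k + 2))) z := by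
  have hne : z - w ≠ 0 := sub_ne_zero.2 h
  have h1 : HasDerivAt (fun z => (z - w)⁻¹) (-1 / (z - w) ^ 2) z :=
    ((hasDerivAt_id z).sub_const w).fun_inv hne
  refine (h1.fun_pow (k + 1)).congr_deriv ?_
  push_cast
  have h2 : (z - w)⁻¹ ^ 2 = 1 / (z - w) ^ 2 := by rw [inv_pow, one_div]
  rw [neg_div, ← h2]
  ring

/-- **Cauchy's integral formula for derivatives** at an arbitrary point of the disc. -/
lemma AnalyticOnNhd.circleIntegral_inv_sub_pow_mul {c w : ℂ} {ρ : ℝ} (hw : w ∈ Metric.ball c ρ)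
    (k : ℕ) {f : ℂ → ℂ} (hf : AnalyticOnNhd ℂ f (Metric.closedBall c ρ)) :
    (∮ z in C(c, ρ), (z - w)⁻¹ ^ (k + 1) * f z)
      = 2 * Real.pi * Complex.I * ((k.factorial : ℂ)⁻¹ * iteratedDeriv k f w) := by
  have hρ : 0 < ρ := Metric.pos_of_mem_ball hw
  induction k generalizing f with
  | zero =>
    simpa using hf.differentiableOn.circleIntegral_sub_inv_smul hw
  | succ k ih =>
    have hne : ∀ z ∈ Metric.sphere c ρ, z ≠ w := by
      rintro z hz rfl
      rw [Metric.mem_sphere] at hz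
      rw [Metric.mem_ball] at hw
      exact hw.ne hz
    -- Integration by parts: the integral of a derivative over the circle vanishes, which trades one
    -- order of the pole for one derivative of `f`.
    have hzero : (∮ z in C(c, ρ), (-((k + 1 : ℂ) * (z - w)⁻¹ ^ (k + 2)) * f z
        + (z - w)⁻¹ ^ (k + 1) * deriv f z)) = 0 := by
      refine circleIntegral.integral_eq_zero_of_hasDerivWithinAt hρ.le
        (f := fun z => (z - w)⁻¹ ^ (k + 1) * f z) fun z hz => ?_
      exact ((hasDerivAt_inv_sub_pow (hne z hz) k).mul
        (hf z (Metric.sphere_subset_closedBall hz)).differentiableAt.hasDerivAt).hasDerivWithinAt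
    have hc : ∀ n : ℕ, ContinuousOn (fun z => (z - w)⁻¹ ^ n) (Metric.sphere c ρ) := fun n =>
      ((continuousOn_id.sub continuousOn_const).inv₀ fun z hz => sub_ne_zero.2 (hne z hz)).pow n
    have hfc : ContinuousOn f (Metric.sphere c ρ) :=
      hf.continuousOn.mono Metric.sphere_subset_closedBall
    have hfd : ContinuousOn (deriv f) (Metric.sphere c ρ) :=
      hf.deriv.continuousOn.mono Metric.sphere_subset_closedBall
    have h1 : CircleIntegrable (fun z => (-(k + 1 : ℂ)) * ((z - w)⁻¹ ^ (k + 2) * f z)) c ρ :=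
      ContinuousOn.circleIntegrable hρ.le (continuousOn_const.mul ((hc (k + 2)).mul hfc))
    have h2 : CircleIntegrable (fun z => (z - w)⁻¹ ^ (k + 1) * deriv f z) c ρ :=
      ContinuousOn.circleIntegrable hρ.le ((hc (k + 1)).mul hfd)
    have hfun : (fun z => -((k + 1 : ℂ) * (z - w)⁻¹ ^ (k + 2)) * f z
        + (z - w)⁻¹ ^ (k + 1) * deriv f z) = fun z => (-(k + 1 : ℂ)) * ((z - w)⁻¹ ^ (k + 2) * f z)
        + (z - w)⁻¹ ^ (k + 1) * deriv f z := by
      funext z; ring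
    rw [hfun, circleIntegral.integral_add h1 h2, ih hf.deriv, ← iteratedDeriv_succ',
      circleIntegral.integral_const_mul] at hzero
    have hk : (k + 1 : ℂ) ≠ 0 := Nat.cast_add_one_ne_zero k
    refine mul_left_cancel₀ hk ?_
    rw [Nat.factorial_succ, Nat.cast_mul, Nat.cast_add, Nat.cast_one, mul_inv]
    linear_combination -hzero - 2 * Real.pi * Complex.I * ((k.factorial : ℂ)⁻¹ *
      iteratedDeriv (k + 1) f w) * mul_inv_cancel₀ hk

/-- The average over the circle is `(2πi)⁻¹ ∮ (z - c)⁻¹ …`, so the factor `z - c` turns it into a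
Cauchy integral. -/
lemma AnalyticOnNhd.circleAverage_inv_sub_pow_mul {c w : ℂ} {ρ : ℝ} (hw : w ∈ Metric.ball c ρ)
    (k : ℕ) {f : ℂ → ℂ} (hf : AnalyticOnNhd ℂ f (Metric.closedBall c ρ)) :
    Real.circleAverage (fun z => (z - c) * (z - w)⁻¹ ^ (k + 1) * f z) c ρ
      = (k.factorial : ℂ)⁻¹ * iteratedDeriv k f w := by
  have hρ : 0 < ρ := Metric.pos_of_mem_ball hw
  rw [Real.circleAverage_eq_circleIntegral hρ.ne', smul_eq_mul,
    circleIntegral.integral_congr (g := fun z => (z - w)⁻¹ ^ (k + 1) * f z) hρ.le,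
    hf.circleIntegral_inv_sub_pow_mul hw, inv_mul_cancel_left₀]
  · simp [Real.pi_ne_zero]
  · intro z hz
    have : z - c ≠ 0 := sub_ne_zero.2 (Metric.ne_of_mem_sphere hz hρ.ne')
    simp only [smul_eq_mul]
    field_simp

/-- **Cauchy's integral formula** for the entries of a matrix function. -/
lemma AnalyticOnNhd.circleAverage_resolvent_mul {m : ℕ} {S : Matrix (Fin m) (Fin m) ℂ} {c : ℂ}
    {ρ : ℝ} (hρ : 0 ≤ ρ) (hS : ∀ z ∈ S.charpoly.roots.toFinset, z ∈ Metric.ball c ρ) {f : ℂ → ℂ}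
    (hf : AnalyticOnNhd ℂ f (Metric.closedBall c ρ)) (i j : Fin m) :
    Real.circleAverage
      (fun z => (z - c) * (Matrix.scalar (Fin m) z - S)⁻¹ i j * f z) c ρ
      = matrixFunctionEntry f S i j := by
  have hnot : ∀ y ∈ Metric.sphere c ρ, y ∉ S.charpoly.roots.toFinset := by
    intro y hy hy'
    exact (Metric.mem_ball.1 (hS y hy')).ne hy
  have hfc : ContinuousOn f (Metric.sphere c ρ) :=
    hf.continuousOn.mono Metric.sphere_subset_closedBall
  have hint : ∀ z ∈ S.charpoly.roots.toFinset, ∀ k : ℕ, CircleIntegrable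
      (fun y => (((S - Matrix.scalar (Fin m) z) ^ k * spectralProjection S z) i j) •
        ((y - c) * (y - z)⁻¹ ^ (k + 1) * f y)) c ρ := by
    intro z hz k
    refine ContinuousOn.circleIntegrable hρ (ContinuousOn.fun_smul continuousOn_const ?_)
    refine ((continuousOn_id.sub continuousOn_const).mul
      (((continuousOn_id.sub continuousOn_const).inv₀ fun y hy => sub_ne_zero.2 ?_).pow _)).mul hfc
    rintro rfl
    exact hnot _ hy hz
  rw [Real.circleAverage_congr_sphere (f₂ := fun y => ∑ z ∈ S.charpoly.roots.toFinset,
    ∑ k ∈ Finset.range m, (((S - Matrix.scalar (Fin m) z) ^ k * spectralProjection S z) i j) •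
        ((y - c) * (y - z)⁻¹ ^ (k + 1) * f y)),
    Real.circleAverage_fun_sum fun z hz => ?_, matrixFunctionEntry]
  · refine Finset.sum_congr rfl fun z hz => ?_
    rw [Real.circleAverage_fun_sum fun k _ => hint z hz k]
    refine Finset.sum_congr rfl fun k _ => ?_
    rw [Real.circleAverage_fun_smul, hf.circleAverage_inv_sub_pow_mul (hS z hz)]
    simp only [smul_eq_mul]
    ring
  · exact CircleIntegrable.fun_sum _ fun k _ => hint z hz k
  · intro y hy
    rw [abs_of_nonneg hρ] at hy
    simp only [inv_scalar_sub S (hnot y hy), Matrix.sum_apply, Matrix.smul_apply, smul_eq_mul,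
      Finset.mul_sum, Finset.sum_mul]
    refine Finset.sum_congr rfl fun z _ => Finset.sum_congr rfl fun k _ => ?_
    ring

/-- Constant functions of matrices are scalar. -/
lemma matrixFunctionEntry_const {m : ℕ} (S : Matrix (Fin m) (Fin m) ℂ) (a : ℂ) (i j : Fin m) :
    matrixFunctionEntry (fun _ => a) S i j = (1 : Matrix (Fin m) (Fin m) ℂ) i j * a := by
  rw [← sum_spectralProjection S, Matrix.sum_apply, Finset.sum_mul, matrixFunctionEntry]
  refine Finset.sum_congr rfl fun z _ => ?_
  rw [Finset.sum_eq_single 0]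
  · simp
  · intro k _ hk
    simp [iteratedDeriv_const, hk]
  · intro h
    have : m = 0 := by simpa using h
    subst this
    exact i.elim0

/-! ### Gram matrices, and discs that contain `S` in norm -/

section Gram

/-- The Gram matrix of the standard basis with respect to an inner product on `ℂ^m`. -/
noncomputable def gramMatrix {m : ℕ} (ip : InnerProductSpace.Core ℂ (Fin m → ℂ)) :
    Matrix (Fin m) (Fin m) ℂ :=
  Matrix.of fun i j => ip.inner (Pi.single i 1) (Pi.single j 1)

lemma InnerProductSpace.Core.inner_sub_smul_self {F : Type*} [AddCommGroup F] [Module ℂ F]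
    (ip : InnerProductSpace.Core ℂ F) (t : ℝ) (w x : F) :
    (ip.inner (x - (t : ℂ) • w) (x - (t : ℂ) • w)).re
      = (ip.inner x x).re - 2 * t * (ip.inner w x).re + t ^ 2 * (ip.inner w w).re := by
  let := ip
  have h1 := InnerProductSpace.Core.inner_sub_left (𝕜 := ℂ) x ((t : ℂ) • w) (x - (t : ℂ) • w)
  have h2 := InnerProductSpace.Core.inner_sub_right (𝕜 := ℂ) x x ((t : ℂ) • w)
  have h3 := InnerProductSpace.Core.inner_sub_right (𝕜 := ℂ) ((t : ℂ) • w) x ((t : ℂ) • w)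
  have h4 := InnerProductSpace.Core.inner_smul_right (𝕜 := ℂ) x w (r := (t : ℂ))
  have h5 := InnerProductSpace.Core.inner_smul_left (𝕜 := ℂ) w x (r := (t : ℂ))
  have h6 := InnerProductSpace.Core.inner_smul_right (𝕜 := ℂ) ((t : ℂ) • w) w (r := (t : ℂ))
  have h7 := InnerProductSpace.Core.inner_smul_left (𝕜 := ℂ) w w (r := (t : ℂ))
  have h8 : (ip.inner x w).re = (ip.inner w x).re := by
    rw [← ip.conj_inner_symm x w, Complex.conj_re]
  rw [h1, h2, h3, h4, h5, h6, h7]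
  simp only [Complex.conj_ofReal, Complex.sub_re, Complex.re_ofReal_mul]
  change (ip.inner x x).re - t * (ip.inner x w).re - (t * (ip.inner w x).re
    - t * (t * (ip.inner w w).re)) = _
  rw [h8]
  ring

lemma InnerProductSpace.Core.exists_inner_map_self_le {F : Type*} [AddCommGroup F] [Module ℂ F]
    [FiniteDimensional ℂ F] (ip : InnerProductSpace.Core ℂ F) (N : F →ₗ[ℂ] F) :
    ∃ C : ℝ, 0 ≤ C ∧ ∀ w, (ip.inner (N w) (N w)).re ≤ C * (ip.inner w w).re := by
  let : NormedAddCommGroup F := ip.toNormedAddCommGroup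
  let : InnerProductSpace ℂ F := InnerProductSpace.ofCore ip.toCore
  refine ⟨‖N.toContinuousLinearMap‖ ^ 2, by positivity, fun w => ?_⟩
  have h1 : ∀ x : F, (ip.inner x x).re = ‖x‖ ^ 2 := fun x => (norm_sq_eq_re_inner (𝕜 := ℂ) x).symm
  rw [h1, h1, ← mul_pow]
  exact pow_le_pow_left₀ (norm_nonneg _) (N.toContinuousLinearMap.le_opNorm w) 2

variable {m : ℕ} (ip : InnerProductSpace.Core ℂ (Fin m → ℂ))

lemma inner_eq_star_dotProduct_gramMatrix (x y : Fin m → ℂ) :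
    ip.inner x y = star x ⬝ᵥ (gramMatrix ip).mulVec y := by
  let := ip
  have hl : ∀ (x y : Fin m → ℂ), ip.inner x y = ∑ i, star (x i) * ip.inner (Pi.single i 1) y := by
    intro x y
    have hadd : ∀ s : Finset (Fin m), ip.inner (∑ i ∈ s, x i • Pi.single i (1 : ℂ)) y
        = ∑ i ∈ s, star (x i) * ip.inner (Pi.single i 1) y := by
      intro s
      induction s using Finset.cons_induction with
      | empty => exact InnerProductSpace.Core.inner_zero_left (𝕜 := ℂ) y
      | cons i s hi ih => rw [Finset.sum_cons, Finset.sum_cons, ip.add_left, ip.smul_left, ih]; rfl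
    rw [← hadd, ← pi_eq_sum_univ']
  have hr : ∀ (x y : Fin m → ℂ), ip.inner x y = ∑ j, ip.inner x (Pi.single j 1) * y j := by
    intro x y
    rw [← ip.conj_inner_symm, hl, map_sum]
    refine Finset.sum_congr rfl fun j _ => ?_
    rw [map_mul, ip.conj_inner_symm, mul_comm]
    simp
  rw [hl]
  refine Finset.sum_congr rfl fun i _ => ?_
  rw [hr]
  rfl

lemma posDef_gramMatrix : (gramMatrix ip).PosDef := by
  refine Matrix.PosDef.of_dotProduct_mulVec_pos ?_ fun x hx => ?_
  · ext i j
    exact ip.conj_inner_symm _ _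
  · rw [← inner_eq_star_dotProduct_gramMatrix, Complex.pos_iff]
    have him : (ip.inner x x).im = 0 := by
      rw [← Complex.conj_eq_iff_im]; exact ip.conj_inner_symm x x
    refine ⟨lt_of_le_of_ne (ip.re_inner_nonneg x) fun h => hx (ip.definite x ?_), him.symm⟩
    exact Complex.ext h.symm him

/-- The defect matrix `ρ² G - (S - c)ᴴ G (S - c)`, which is positive definite when `S - c` has
norm less than `ρ`. -/
noncomputable def defectMatrix (G S : Matrix (Fin m) (Fin m) ℂ) (c : ℂ) (ρ : ℝ) :
    Matrix (Fin m) (Fin m) ℂ :=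
  (ρ ^ 2 : ℂ) • G - (S - Matrix.scalar (Fin m) c).conjTranspose * G * (S - Matrix.scalar (Fin m) c)

lemma sub_scalar_mulVec (S : Matrix (Fin m) (Fin m) ℂ) (c : ℂ) (w : Fin m → ℂ) :
    (S - Matrix.scalar (Fin m) c).mulVec w = S.mulVec w - c • w := by
  rw [Matrix.sub_mulVec]
  congr 1
  ext i
  simp [Matrix.scalar_apply, Matrix.mulVec_diagonal]

lemma star_dotProduct_defectMatrix (G S : Matrix (Fin m) (Fin m) ℂ) (c : ℂ) (ρ : ℝ)
    (w : Fin m → ℂ) :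
    star w ⬝ᵥ (defectMatrix G S c ρ).mulVec w = (ρ ^ 2 : ℂ) * (star w ⬝ᵥ G.mulVec w)
      - star (S.mulVec w - c • w) ⬝ᵥ G.mulVec (S.mulVec w - c • w) := by
  rw [defectMatrix, Matrix.sub_mulVec, dotProduct_sub, Matrix.smul_mulVec, dotProduct_smul,
    smul_eq_mul, ← sub_scalar_mulVec, Matrix.star_mulVec, ← Matrix.dotProduct_mulVec,
    Matrix.mulVec_mulVec, Matrix.mulVec_mulVec, mul_assoc]

lemma isHermitian_defectMatrix {G : Matrix (Fin m) (Fin m) ℂ} (hG : G.IsHermitian)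
    (S : Matrix (Fin m) (Fin m) ℂ) (c : ℂ) (ρ : ℝ) : (defectMatrix G S c ρ).IsHermitian := by
  have h : IsSelfAdjoint (ρ ^ 2 : ℂ) := by
    rw [isSelfAdjoint_iff]
    simp
  exact (hG.smul h).sub (Matrix.isHermitian_conjTranspose_mul_mul _ hG)

/-- A matrix with numerical range in `{Re s ≥ σ}` has its shift by a suitable `c` bounded by the
radius of a disc around `c` inside `{Re s > σ - ε}`. -/
lemma exists_posDef_defectMatrix {σ ε : ℝ} (hε : 0 < ε) (S : Matrix (Fin m) (Fin m) ℂ)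
    (hS : ∀ w : Fin m → ℂ, σ * (ip.inner w w).re ≤ (ip.inner w (S.mulVec w)).re) :
    ∃ (c : ℂ) (ρ : ℝ), 0 < ρ ∧ Metric.closedBall c ρ ⊆ {s | σ - ε < s.re} ∧
      (defectMatrix (gramMatrix ip) S c ρ).PosDef := by
  obtain ⟨C, hC, hN⟩ := ip.exists_inner_map_self_le
    (Matrix.toLin' S - (σ : ℂ) • (1 : Module.End ℂ (Fin m → ℂ)))
  have ht : 0 ≤ C / ε := by positivity
  -- Put `N = S - σ` and `t = C / ε`. As `Re (w, N w) ≥ 0`, `|(N - t) w|² ≤ (C + t²) |w|²`, while `ρ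
  -- = t + ε / 2` has `ρ² = t² + C + ε² / 4`. The leftmost point of the disc is `σ - ε / 2`.
  refine ⟨((σ + C / ε : ℝ) : ℂ), C / ε + ε / 2, by positivity, ?_, ?_⟩
  · intro s hs
    rw [mem_closedBall_iff_norm] at hs
    have h1 := (Complex.abs_re_le_norm _).trans hs
    rw [Complex.sub_re, Complex.ofReal_re] at h1
    have h2 := (abs_le.1 h1).1
    simp only [Set.mem_ofPred_eq]
    linarith
  · refine Matrix.PosDef.of_dotProduct_mulVec_pos
      (isHermitian_defectMatrix (posDef_gramMatrix ip).isHermitian S _ _) fun w hw => ?_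
    have hherm := isHermitian_defectMatrix (posDef_gramMatrix ip).isHermitian S
      ((σ + C / ε : ℝ) : ℂ) (C / ε + ε / 2)
    have hpos := (posDef_gramMatrix ip).dotProduct_mulVec_pos hw
    rw [← inner_eq_star_dotProduct_gramMatrix, Complex.pos_iff] at hpos
    have him : (star w ⬝ᵥ (defectMatrix (gramMatrix ip) S ((σ + C / ε : ℝ) : ℂ)
        (C / ε + ε / 2)).mulVec w).im = 0 := by
      simpa using hherm.im_star_dotProduct_mulVec_self w
    rw [Complex.pos_iff]
    refine ⟨?_, him.symm⟩
    rw [star_dotProduct_defectMatrix, ← inner_eq_star_dotProduct_gramMatrix,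
      ← inner_eq_star_dotProduct_gramMatrix]
    have hsplit : S.mulVec w - ((σ + C / ε : ℝ) : ℂ) • w
        = (S.mulVec w - (σ : ℂ) • w) - ((C / ε : ℝ) : ℂ) • w := by
      rw [Complex.ofReal_add, add_smul, sub_sub]
    have hre : 0 ≤ (ip.inner w (S.mulVec w - (σ : ℂ) • w)).re := by
      have h1 : ip.inner w (S.mulVec w - (σ : ℂ) • w)
          = ip.inner w (S.mulVec w) - (σ : ℂ) * ip.inner w w := by
        rw [inner_eq_star_dotProduct_gramMatrix, inner_eq_star_dotProduct_gramMatrix,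
          inner_eq_star_dotProduct_gramMatrix, Matrix.mulVec_sub, Matrix.mulVec_smul,
          dotProduct_sub, dotProduct_smul, smul_eq_mul]
      rw [h1, Complex.sub_re, Complex.re_ofReal_mul]
      linarith [hS w]
    have hNw : (ip.inner (S.mulVec w - (σ : ℂ) • w) (S.mulVec w - (σ : ℂ) • w)).re
        ≤ C * (ip.inner w w).re := hN w
    rw [hsplit, Complex.sub_re, ip.inner_sub_smul_self, ← Complex.ofReal_pow,
      Complex.re_ofReal_mul]
    have hεC : C / ε * ε = C := div_mul_cancel₀ _ hε.ne'
    have := mul_nonneg ht hre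
    have h2 : 0 < ε ^ 2 / 4 * (ip.inner w w).re := mul_pos (by positivity) hpos.1
    have h3 : (C / ε + ε / 2) ^ 2 = (C / ε) ^ 2 + C + ε ^ 2 / 4 := by
      linear_combination hεC
    rw [h3]
    nlinarith

end Gram

/-! ### The positive kernel on the circle -/

section Kernel

variable {m : ℕ} {G S : Matrix (Fin m) (Fin m) ℂ} {c : ℂ} {ρ : ℝ}

/-- On an eigenvector `w` for `z` the defect form equals `(ρ² - |z - c|²) wᴴ G w`. -/
lemma mem_ball_of_posDef_defectMatrix (hρ : 0 < ρ) (hG : G.PosDef)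
    (hD : (defectMatrix G S c ρ).PosDef) :
    ∀ z ∈ S.charpoly.roots.toFinset, z ∈ Metric.ball c ρ := by
  intro z hz
  obtain ⟨w, hw⟩ := ((mem_charpoly_roots_toFinset S z).1 hz).exists_hasEigenvector
  have hSw : S.mulVec w = z • w := by simpa using hw.apply_eq_smul
  have h1 := hD.dotProduct_mulVec_pos hw.2
  have h2 := hG.dotProduct_mulVec_pos hw.2
  rw [star_dotProduct_defectMatrix, hSw, ← sub_smul, star_smul, smul_dotProduct,
    Matrix.mulVec_smul, dotProduct_smul, smul_eq_mul, smul_eq_mul, ← mul_assoc, ← sub_mul] at h1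
  rw [Complex.pos_iff] at h1 h2
  have h3 : (ρ ^ 2 : ℂ) - star (z - c) * (z - c) = ((ρ ^ 2 - ‖z - c‖ ^ 2 : ℝ) : ℂ) := by
    rw [Complex.star_def, Complex.conj_mul']
    push_cast
    ring
  rw [h3, Complex.re_ofReal_mul] at h1
  have h4 := pos_of_mul_pos_left h1.1 h2.1.le
  rw [mem_ball_iff_norm]
  exact lt_of_pow_lt_pow_left₀ 2 hρ.le (by linarith)

/-- The kernel that represents matrix functions as circle averages. -/
noncomputable def discKernel (G S : Matrix (Fin m) (Fin m) ℂ) (c : ℂ) (ρ : ℝ) (z : ℂ) :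
    Matrix (Fin m) (Fin m) ℂ :=
  ((Matrix.scalar (Fin m) z - S)⁻¹).conjTranspose * defectMatrix G S c ρ *
    (Matrix.scalar (Fin m) z - S)⁻¹

/-- With `U = z - S` and `ζ = z - c`, substitute `S - c = ζ - U` in the defect matrix: on the circle
`ρ² = |ζ|²` cancels the term `|ζ|² G`, and conjugation by `U⁻¹` simplifies the rest. -/
lemma discKernel_eq {z : ℂ} (hz : ‖z - c‖ = ρ) (hU : IsUnit (Matrix.scalar (Fin m) z - S)) :
    discKernel G S c ρ z = (z - c) • (G * (Matrix.scalar (Fin m) z - S)⁻¹)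
      + (star (z - c) • ((Matrix.scalar (Fin m) z - S)⁻¹).conjTranspose - 1) * G := by
  set U := Matrix.scalar (Fin m) z - S with hUdef
  have hT : S - Matrix.scalar (Fin m) c = (z - c) • (1 : Matrix (Fin m) (Fin m) ℂ) - U := by
    ext i j
    simp only [hUdef, Matrix.sub_apply, Matrix.smul_apply, Matrix.scalar_apply,
      Matrix.diagonal_apply, Matrix.one_apply, smul_eq_mul]
    split_ifs <;> ring
  have hρ : (ρ ^ 2 : ℂ) = star (z - c) * (z - c) := by
    rw [Complex.star_def, Complex.conj_mul', hz]
  have hD : defectMatrix G S c ρ = (z - c) • (U.conjTranspose * G) + star (z - c) • (G * U)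
      - U.conjTranspose * G * U := by
    generalize z - c = ζ at hT hρ ⊢
    rw [defectMatrix, hT, hρ, Matrix.conjTranspose_sub, Matrix.conjTranspose_smul,
      Matrix.conjTranspose_one]
    simp only [sub_mul, mul_sub, smul_mul_assoc, mul_smul_comm, one_mul, mul_one, smul_sub,
      smul_smul]
    rw [mul_comm (star ζ)]
    abel
  have h1 : U * U⁻¹ = 1 := Matrix.mul_nonsing_inv _ ((Matrix.isUnit_iff_isUnit_det _).1 hU)
  have h2 : (U⁻¹).conjTranspose * U.conjTranspose = 1 := by
    rw [← Matrix.conjTranspose_mul, h1, Matrix.conjTranspose_one]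
  have h3 : (U⁻¹).conjTranspose * (U.conjTranspose * G) * U⁻¹ = G * U⁻¹ := by
    rw [← mul_assoc, h2, one_mul]
  have h4 : (U⁻¹).conjTranspose * (G * U) * U⁻¹ = (U⁻¹).conjTranspose * G := by
    rw [mul_assoc, mul_assoc G, h1, mul_one]
  have h5 : (U⁻¹).conjTranspose * (U.conjTranspose * G * U) * U⁻¹ = G := by
    rw [← mul_assoc, ← mul_assoc, h2, one_mul, mul_assoc, h1, mul_one]
  rw [discKernel, ← hUdef, hD]
  simp only [sub_mul, mul_sub, mul_add, add_mul, smul_mul_assoc, mul_smul_comm, one_mul, h3, h4, h5]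
  rw [add_sub_assoc]

end Kernel

/-! ### Regularity of inverse matrices -/

section Regularity

-- The operator norm serves only to differentiate inversion in a Banach algebra; the entrywise
-- statement does not depend on it.
attribute [local instance] Matrix.linftyOpNormedRing Matrix.linftyOpNormedAlgebra in
lemma differentiableAt_inv_add_smul_apply {m : ℕ} (A B : Matrix (Fin m) (Fin m) ℂ) (i j : Fin m)
    {z : ℂ} (h : IsUnit (A + z • B)) : DifferentiableAt ℂ (fun z : ℂ => (A + z • B)⁻¹ i j) z := by
  have h1 : DifferentiableAt ℂ (fun z : ℂ => A + z • B) z := by fun_prop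
  have h2 : DifferentiableAt ℂ (fun z : ℂ => Ring.inverse (A + z • B)) z :=
    DifferentiableAt.fun_comp' z (differentiableAt_inverse h) h1
  have h3 : DifferentiableAt ℂ (fun z : ℂ => (A + z • B)⁻¹) z := by
    simpa only [Matrix.nonsing_inv_eq_ringInverse] using h2
  exact ((Matrix.entryLinearMap ℂ ℂ i j).toContinuousLinearMap.differentiableAt).comp z h3

end Regularity

/-! ### Averages against the kernel -/

section Average

variable {m : ℕ} {G S : Matrix (Fin m) (Fin m) ℂ} {c : ℂ} {ρ : ℝ}

lemma continuousOn_resolvent_apply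
    (hS : ∀ z ∈ S.charpoly.roots.toFinset, z ∈ Metric.ball c ρ) (i j : Fin m) :
    ContinuousOn (fun z => (Matrix.scalar (Fin m) z - S)⁻¹ i j) (Metric.sphere c ρ) := by
  intro z hz
  have hU : IsUnit (Matrix.scalar (Fin m) z - S) :=
    isUnit_scalar_sub S fun h => (Metric.mem_ball.1 (hS z h)).ne hz
  have heq : ∀ z : ℂ, Matrix.scalar (Fin m) z - S = -S + z • (1 : Matrix (Fin m) (Fin m) ℂ) := by
    intro z
    ext i j
    simp only [Matrix.sub_apply, Matrix.add_apply, Matrix.neg_apply, Matrix.smul_apply,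
      Matrix.scalar_apply, Matrix.diagonal_apply, Matrix.one_apply, smul_eq_mul]
    split_ifs <;> ring
  simp only [heq] at hU ⊢
  exact (differentiableAt_inv_add_smul_apply _ _ i j hU).continuousAt.continuousWithinAt

/-- The holomorphic extension to the disc of the adjoint of `(z - c) (z - S)⁻¹` on the circle. -/
noncomputable def reflectedResolvent (S : Matrix (Fin m) (Fin m) ℂ) (c : ℂ) (ρ : ℝ) (z : ℂ) :
    Matrix (Fin m) (Fin m) ℂ :=
  (1 - ((z - c) / ρ ^ 2) • (S - Matrix.scalar (Fin m) c).conjTranspose)⁻¹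

/-- For `z ≠ c` the matrix is a nonzero multiple of `(y - S)ᴴ`, where `y` is the inversion of `z` in
the circle. This `y` lies outside the open disc and so is no eigenvalue. -/
lemma isUnit_one_sub_smul_conjTranspose
    (hS : ∀ z ∈ S.charpoly.roots.toFinset, z ∈ Metric.ball c ρ) {z : ℂ}
    (hρ : 0 < ρ) (hz : z ∈ Metric.closedBall c ρ) :
    IsUnit (1 - ((z - c) / ρ ^ 2) • (S - Matrix.scalar (Fin m) c).conjTranspose) := by
  rcases eq_or_ne z c with rfl | hne
  · simp
  have hζ : z - c ≠ 0 := sub_ne_zero.2 hne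
  have hζ' : star (z - c) ≠ 0 := star_ne_zero.2 hζ
  have hρ' : (ρ : ℂ) ≠ 0 := by exact_mod_cast hρ.ne'
  set y : ℂ := c + ρ ^ 2 / star (z - c) with hy
  have hynot : y ∉ S.charpoly.roots.toFinset := by
    intro h
    have h1 := hS y h
    rw [mem_ball_iff_norm, hy, add_sub_cancel_left, norm_div, norm_star, norm_pow,
      Complex.norm_real, Real.norm_of_nonneg hρ.le, div_lt_iff₀ (norm_pos_iff.2 hζ)] at h1
    rw [mem_closedBall_iff_norm] at hz
    nlinarith
  have hU := isUnit_scalar_sub S hynot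
  have heq : 1 - ((z - c) / ρ ^ 2) • (S - Matrix.scalar (Fin m) c).conjTranspose
      = (((star (z - c) / ρ ^ 2) • (Matrix.scalar (Fin m) y - S))).conjTranspose := by
    rw [← Matrix.conjTranspose_one, ← Complex.conj_conj ((z - c) / ρ ^ 2), ← Complex.star_def,
      ← Matrix.conjTranspose_smul, ← Matrix.conjTranspose_sub]
    congr 1
    have h2 : star ((z - c) / (ρ : ℂ) ^ 2) = star (z - c) / ρ ^ 2 := by simp
    rw [h2]
    ext i j
    simp only [Matrix.sub_apply, Matrix.smul_apply, Matrix.scalar_apply,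
      Matrix.diagonal_apply, Matrix.one_apply, smul_eq_mul, hy]
    split_ifs
    · field_simp
      ring
    · ring
  rw [heq, Matrix.isUnit_conjTranspose]
  exact (isUnit_smul_iff (Units.mk0 _ (div_ne_zero hζ' (pow_ne_zero 2 hρ'))) _).2 hU

lemma differentiableOn_reflectedResolvent
    (hS : ∀ z ∈ S.charpoly.roots.toFinset, z ∈ Metric.ball c ρ) (hρ : 0 < ρ) (i j : Fin m) :
    DifferentiableOn ℂ (fun z => reflectedResolvent S c ρ z i j) (Metric.closedBall c ρ) := by
  intro z hz
  have hU := isUnit_one_sub_smul_conjTranspose hS hρ hz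
  have heq : ∀ z : ℂ, 1 - ((z - c) / ρ ^ 2) • (S - Matrix.scalar (Fin m) c).conjTranspose
      = (1 + (c / ρ ^ 2) • (S - Matrix.scalar (Fin m) c).conjTranspose)
        + z • (-((1 / ρ ^ 2 : ℂ) • (S - Matrix.scalar (Fin m) c).conjTranspose)) := by
    intro z
    rw [sub_div, sub_smul, smul_neg, smul_smul, mul_one_div]
    abel
  simp only [reflectedResolvent]
  simp only [heq] at hU ⊢
  exact (differentiableAt_inv_add_smul_apply _ _ i j hU).differentiableWithinAt

lemma reflectedResolvent_of_norm_eq {z : ℂ} (hρ : 0 < ρ) (hz : ‖z - c‖ = ρ) :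
    reflectedResolvent S c ρ z
      = star (z - c) • ((Matrix.scalar (Fin m) z - S)⁻¹).conjTranspose := by
  have hζ : z - c ≠ 0 := norm_pos_iff.1 (hz ▸ hρ)
  have hζ' : star (z - c) ≠ 0 := star_ne_zero.2 hζ
  have hρ2 : (ρ ^ 2 : ℂ) = star (z - c) * (z - c) := by
    rw [Complex.star_def, Complex.conj_mul', hz]
  have heq : 1 - ((z - c) / ρ ^ 2) • (S - Matrix.scalar (Fin m) c).conjTranspose
      = (star (z - c))⁻¹ • (Matrix.scalar (Fin m) z - S).conjTranspose := by
    ext i j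
    simp only [Matrix.sub_apply, Matrix.smul_apply, Matrix.scalar_apply,
      Matrix.diagonal_apply, Matrix.one_apply, smul_eq_mul, Matrix.conjTranspose_apply, hρ2,
      star_sub, eq_comm (a := i)]
    simp only [star_sub] at hζ'
    split_ifs
    · field_simp
      ring
    · field_simp
      simp
  have := invertibleOfNonzero (inv_ne_zero hζ')
  rw [reflectedResolvent, heq, Matrix.conjTranspose_nonsing_inv]
  -- If `z - S` is singular, both inverses take the default value `0`, so no spectral hypothesis is
  -- needed.
  by_cases hU : IsUnit (Matrix.scalar (Fin m) z - S).conjTranspose.det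
  · rw [Matrix.inv_smul _ _ hU, invOf_eq_inv, inv_inv]
  · have hU2 : ¬ IsUnit ((star (z - c))⁻¹ • (Matrix.scalar (Fin m) z - S).conjTranspose).det := by
      rw [← Matrix.isUnit_iff_isUnit_det] at hU ⊢
      exact fun h => hU ((isUnit_smul_iff (Units.mk0 _ (inv_ne_zero hζ')) _).1 h)
    rw [Matrix.nonsing_inv_apply_not_isUnit _ hU, Matrix.nonsing_inv_apply_not_isUnit _ hU2,
      smul_zero]

lemma continuousOn_discKernel
    (hS : ∀ z ∈ S.charpoly.roots.toFinset, z ∈ Metric.ball c ρ) (a b : Fin m) :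
    ContinuousOn (fun z => discKernel G S c ρ z a b) (Metric.sphere c ρ) := by
  have h := continuousOn_resolvent_apply hS
  simp only [discKernel, Matrix.mul_apply, Matrix.conjTranspose_apply]
  refine continuousOn_finsetSum _ fun i _ => ContinuousOn.mul
    (continuousOn_finsetSum _ fun j _ => ?_) (h _ _)
  exact ((h _ _).star).mul continuousOn_const

lemma AnalyticOnNhd.circleAverage_discKernel_mul (hρ : 0 < ρ)
    (hS : ∀ z ∈ S.charpoly.roots.toFinset, z ∈ Metric.ball c ρ) {f : ℂ → ℂ}
    (hf : AnalyticOnNhd ℂ f (Metric.closedBall c ρ)) (a b : Fin m) :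
    Real.circleAverage (fun z => discKernel G S c ρ z a b * f z) c ρ
      = ∑ e, G a e * matrixFunctionEntry f S e b := by
  have hfc : ContinuousOn f (Metric.sphere c ρ) :=
    hf.continuousOn.mono Metric.sphere_subset_closedBall
  have hd : ∀ e, DifferentiableOn ℂ
      (fun z => (reflectedResolvent S c ρ z a e - (1 : Matrix (Fin m) (Fin m) ℂ) a e) * f z)
      (Metric.closedBall c ρ) := fun e =>
    ((differentiableOn_reflectedResolvent hS hρ a e).sub_const _).mul hf.differentiableOn
  have h1 : ∀ e, CircleIntegrable (fun z => G a e •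
      ((z - c) * (Matrix.scalar (Fin m) z - S)⁻¹ e b * f z)) c ρ := fun e =>
    ContinuousOn.circleIntegrable hρ.le (continuousOn_const.fun_smul
      (((continuousOn_id.sub continuousOn_const).mul (continuousOn_resolvent_apply hS e b)).mul hfc))
  have h2 : ∀ e, CircleIntegrable (fun z => G e b • ((reflectedResolvent S c ρ z a e
      - (1 : Matrix (Fin m) (Fin m) ℂ) a e) * f z)) c ρ := fun e =>
    ContinuousOn.circleIntegrable hρ.le (continuousOn_const.fun_smul
      ((hd e).continuousOn.mono Metric.sphere_subset_closedBall))
  rw [Real.circleAverage_congr_sphere (f₂ := fun z =>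
    (∑ e, G a e • ((z - c) * (Matrix.scalar (Fin m) z - S)⁻¹ e b * f z))
    + ∑ e, G e b • ((reflectedResolvent S c ρ z a e
      - (1 : Matrix (Fin m) (Fin m) ℂ) a e) * f z)),
    Real.circleAverage_fun_add (CircleIntegrable.fun_sum _ fun e _ => h1 e)
      (CircleIntegrable.fun_sum _ fun e _ => h2 e),
    Real.circleAverage_fun_sum fun e _ => h1 e, Real.circleAverage_fun_sum fun e _ => h2 e]
  -- Mean value property: the integrand extends holomorphically to the disc, and
  -- `reflectedResolvent` is the identity at `c`.
  · have hzero : ∀ e, Real.circleAverage (fun z => G e b • ((reflectedResolvent S c ρ z a e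
        - (1 : Matrix (Fin m) (Fin m) ℂ) a e) * f z)) c ρ = 0 := by
      intro e
      rw [Real.circleAverage_fun_smul, DiffContOnCl.circleAverage]
      · simp [reflectedResolvent]
      · rw [abs_of_pos hρ]
        exact ((hd e).mono Metric.closure_ball_subset_closedBall).diffContOnCl
    rw [Finset.sum_eq_zero fun e _ => hzero e, add_zero]
    refine Finset.sum_congr rfl fun e _ => ?_
    rw [Real.circleAverage_fun_smul, hf.circleAverage_resolvent_mul hρ.le hS, smul_eq_mul]
  · intro z hz
    rw [abs_of_pos hρ] at hz
    have hU : IsUnit (Matrix.scalar (Fin m) z - S) :=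
      isUnit_scalar_sub S fun h => (Metric.mem_ball.1 (hS z h)).ne hz
    rw [mem_sphere_iff_norm] at hz
    simp only
    rw [discKernel_eq hz hU, ← reflectedResolvent_of_norm_eq hρ hz]
    simp only [Matrix.add_apply, Matrix.smul_apply, Matrix.mul_apply, Matrix.sub_apply, smul_eq_mul,
      add_mul, Finset.mul_sum, Finset.sum_mul]
    congr 1 <;> refine Finset.sum_congr rfl fun e _ => ?_ <;> ring

end Average

/-! ### Positivity of tensored forms -/

section Positivity

/-- A positive semidefinite matrix is a sum of rank-one terms `a aᴴ`. The vectors are chosen before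
the spaces and the form, so that one decomposition serves all three forms in
`Matrix.PosSemidef.coercivity`. -/
lemma Matrix.PosSemidef.exists_sum_mul_sesquilinear {m : ℕ} {K : Matrix (Fin m) (Fin m) ℂ}
    (hK : K.PosSemidef) : ∃ (n : ℕ) (A : Fin n → Fin m → ℂ), ∀ {V W : Type*} [AddCommGroup V]
      [Module ℂ V] [AddCommGroup W] [Module ℂ W] (φ : V →ₗ⋆[ℂ] W →ₗ[ℂ] ℂ) (x : Fin m → V)
      (y : Fin m → W), ∑ a, ∑ b, K a b * φ (x a) (y b)
        = ∑ k, φ (∑ a, A k a • x a) (∑ b, A k b • y b) := by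
  obtain ⟨n, A, rfl⟩ := Matrix.posSemidef_iff_eq_sum_vecMulVec.1 hK
  -- The coefficients are conjugated because `φ` is antilinear in its first argument.
  refine ⟨n, fun k a => star (A k a), fun φ x y => ?_⟩
  simp only [Matrix.sum_apply, Matrix.vecMulVec_apply, map_sum, LinearMap.sum_apply, map_smulₛₗ,
    LinearMap.smul_apply, smul_eq_mul, Finset.sum_mul, Finset.mul_sum, Pi.star_apply]
  rw [Finset.sum_congr rfl fun a _ => Finset.sum_comm, Finset.sum_comm]
  refine Finset.sum_congr rfl fun k _ => ?_
  rw [Finset.sum_comm]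
  refine Finset.sum_congr rfl fun b _ => Finset.sum_congr rfl fun a _ => ?_
  simp
  ring

variable {V : Type*} [NormedAddCommGroup V] [InnerProductSpace ℂ V]

/-- The sesquilinear form of an operator `V → V'`. -/
noncomputable def operatorForm (A : V →L[ℂ] AntiDual V) : V →ₗ⋆[ℂ] V →ₗ[ℂ] ℂ :=
  LinearMap.mk₂'ₛₗ (starRingEnd ℂ) (RingHom.id ℂ) (fun x y => A y x)
    (by simp) (by simp) (by simp) (by simp)

/-- Coercivity of an operator pencil survives tensoring with a positive semidefinite matrix. -/
lemma Matrix.PosSemidef.coercivity {m : ℕ} {K : Matrix (Fin m) (Fin m) ℂ} (hK : K.PosSemidef)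
    {α : ℝ} (hα : 0 ≤ α) {A : V →L[ℂ] AntiDual V} {B : V →L[ℂ] V}
    (h : ∀ v, α * ‖B v‖ ^ 2 ≤ (A v v).re) (v w : Fin m → V) :
    0 ≤ ((∑ a, ∑ b, K a b * A (v b) (v a)) - 2 * α * (∑ a, ∑ b, K a b * inner ℂ (w a) (B (v b)))
      + α * (∑ a, ∑ b, K a b * inner ℂ (w a) (w b))).re := by
  obtain ⟨n, P, hP⟩ := hK.exists_sum_mul_sesquilinear
  have h1 := hP (operatorForm A) v v
  have h2 := hP ((innerₛₗ ℂ : V →ₗ⋆[ℂ] V →ₗ[ℂ] ℂ).compl₂ (B : V →ₗ[ℂ] V)) w v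
  have h3 := hP (innerₛₗ ℂ : V →ₗ⋆[ℂ] V →ₗ[ℂ] ℂ) w w
  simp only [operatorForm, LinearMap.mk₂'ₛₗ_apply, LinearMap.compl₂_apply, innerₛₗ_apply_apply,
    ContinuousLinearMap.coe_coe] at h1 h2 h3
  rw [h1, h2, h3, Finset.mul_sum, Finset.mul_sum, ← Finset.sum_sub_distrib,
    ← Finset.sum_add_distrib, Complex.re_sum]
  refine Finset.sum_nonneg fun k _ => ?_
  generalize ∑ a, P k a • v a = y
  generalize ∑ a, P k a • w a = x
  have h4 := norm_sub_sq (𝕜 := ℂ) x (B y)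
  have h5 : (inner ℂ x x).re = ‖x‖ ^ 2 := (norm_sq_eq_re_inner (𝕜 := ℂ) x).symm
  -- Completing the square: each summand is at least `α‖x - B y‖²`.
  have h6 : (0 : ℝ) ≤ α * ‖x - B y‖ ^ 2 := by positivity
  have h7 : (2 * (α : ℂ)) = ((2 * α : ℝ) : ℂ) := by push_cast; ring
  rw [h7, Complex.add_re, Complex.sub_re, Complex.re_ofReal_mul, Complex.re_ofReal_mul, h5]
  rw [h4] at h6
  have h8 := h y
  change 0 ≤ α * (‖x‖ ^ 2 - 2 * (inner ℂ x (B y)).re + ‖B y‖ ^ 2) at h6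
  nlinarith

lemma blockInner_self_re_nonneg {m : ℕ} (ip : InnerProductSpace.Core ℂ (Fin m → ℂ))
    (v : Fin m → V) : 0 ≤ (blockInner ip v v).re := by
  obtain ⟨n, P, hP⟩ := (posDef_gramMatrix ip).posSemidef.exists_sum_mul_sesquilinear
  have h3 := hP (innerₛₗ ℂ : V →ₗ⋆[ℂ] V →ₗ[ℂ] ℂ) v v
  simp only [innerₛₗ_apply_apply] at h3
  change 0 ≤ (∑ i, ∑ j, gramMatrix ip i j * inner ℂ (v i) (v j)).re
  rw [h3, Complex.re_sum]
  exact Finset.sum_nonneg fun k _ => inner_self_nonneg (𝕜 := ℂ)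

end Positivity

/-! ### Double sums against the kernel -/

section Average

variable {m : ℕ} {G S : Matrix (Fin m) (Fin m) ℂ} {c : ℂ} {ρ : ℝ}

lemma circleIntegrable_sum_discKernel_mul (hρ : 0 < ρ)
    (hS : ∀ z ∈ S.charpoly.roots.toFinset, z ∈ Metric.ball c ρ) {h : Fin m → Fin m → ℂ → ℂ}
    (hh : ∀ a b, AnalyticOnNhd ℂ (h a b) (Metric.closedBall c ρ)) (a b : Fin m) :
    CircleIntegrable (fun z => discKernel G S c ρ z a b * h a b z) c ρ :=
  ContinuousOn.circleIntegrable hρ.le ((continuousOn_discKernel hS a b).mul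
    ((hh a b).continuousOn.mono Metric.sphere_subset_closedBall))

lemma circleAverage_sum_discKernel_mul (hρ : 0 < ρ)
    (hS : ∀ z ∈ S.charpoly.roots.toFinset, z ∈ Metric.ball c ρ) {h : Fin m → Fin m → ℂ → ℂ}
    (hh : ∀ a b, AnalyticOnNhd ℂ (h a b) (Metric.closedBall c ρ)) :
    Real.circleAverage (fun z => ∑ a, ∑ b, discKernel G S c ρ z a b * h a b z) c ρ
      = ∑ a, ∑ e, G a e * ∑ b, matrixFunctionEntry (h a b) S e b := by
  have hi := circleIntegrable_sum_discKernel_mul (G := G) hρ hS hh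
  rw [Real.circleAverage_fun_sum fun a _ => CircleIntegrable.fun_sum _ fun b _ => hi a b]
  refine Finset.sum_congr rfl fun a _ => ?_
  rw [Real.circleAverage_fun_sum fun b _ => hi a b]
  simp only [(hh a _).circleAverage_discKernel_mul hρ hS, Finset.mul_sum]
  exact Finset.sum_comm

lemma Real.circleAverage_re_nonneg {f : ℂ → ℂ} (hf : CircleIntegrable f c ρ)
    (h : ∀ z ∈ Metric.sphere c |ρ|, 0 ≤ (f z).re) : 0 ≤ (Real.circleAverage f c ρ).re := by
  have := Complex.reCLM.circleAverage_comp_comm hf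
  rw [← Complex.reCLM_apply, ← this]
  exact Real.circleAverage_nonneg_of_nonneg h

end Average

/-! ### Reduction of operator-valued matrix functions to scalar ones -/

section MatrixFunction

variable {E F : Type*} [NormedAddCommGroup E] [NormedSpace ℂ E] [NormedAddCommGroup F]
  [NormedSpace ℂ F] [CompleteSpace F] {m : ℕ}

lemma AnalyticAt.iteratedDeriv_clm_comp {f : ℂ → F} {z : ℂ} (hf : AnalyticAt ℂ f z) (g : F →L[ℂ] ℂ)
    (k : ℕ) : iteratedDeriv k (fun s => g (f s)) z = g (iteratedDeriv k f z) := by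
  have h := g.iteratedFDeriv_comp_left (hf.contDiffAt (n := (k : WithTop ℕ∞))) (i := k) le_rfl
  rw [iteratedDeriv_eq_iteratedFDeriv, iteratedDeriv_eq_iteratedFDeriv]
  change (iteratedFDeriv ℂ k (g ∘ f) z) _ = _
  rw [h]
  rfl

/-- A functional of a matrix function is a sum of entries of scalar matrix functions. -/
lemma clm_matrixFunction {f : ℂ → E →L[ℂ] F} {S : Matrix (Fin m) (Fin m) ℂ}
    (hf : ∀ z ∈ S.charpoly.roots.toFinset, AnalyticAt ℂ f z) (g : F →L[ℂ] ℂ) (v : Fin m → E)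
    (e : Fin m) :
    g (matrixFunction f S v e) = ∑ b, matrixFunctionEntry (fun s => g (f s (v b))) S e b := by
  simp only [matrixFunction, matrixFunctionEntry, map_sum, map_smul, smul_eq_mul]
  symm
  rw [Finset.sum_comm]
  refine Finset.sum_congr rfl fun z hz => ?_
  rw [Finset.sum_comm]
  refine Finset.sum_congr rfl fun k _ => Finset.sum_congr rfl fun b _ => ?_
  congr 1
  exact ((hf z hz).iteratedDeriv_clm_comp 
    (g ∘L (ContinuousLinearMap.apply ℂ F (v b) : (E →L[ℂ] F) →L[ℂ] F)) k)

end MatrixFunction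

/-! ### Coercivity on a disc -/

section Coercivity

variable {V : Type*} [NormedAddCommGroup V] [InnerProductSpace ℂ V] [CompleteSpace V] {m : ℕ}

/-- Coercivity of a matrix function for operator families that are analytic and coercive on a disc
that contains the matrix in the sense of the norm. -/
lemma coercivity_of_posDef_defectMatrix (ip : InnerProductSpace.Core ℂ (Fin m → ℂ)) {α : ℝ}
    (hα : 0 ≤ α) {L : ℂ → V →L[ℂ] AntiDual V} {R : ℂ → V →L[ℂ] V} {c : ℂ} {ρ : ℝ} (hρ : 0 < ρ)
    (hL : AnalyticOnNhd ℂ L (Metric.closedBall c ρ))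
    (hR : AnalyticOnNhd ℂ R (Metric.closedBall c ρ))
    (hpos : ∀ (v : V), ∀ s ∈ Metric.closedBall c ρ, α * ‖R s v‖ ^ 2 ≤ (L s v v).re)
    {S : Matrix (Fin m) (Fin m) ℂ} (hD : (defectMatrix (gramMatrix ip) S c ρ).PosDef)
    (v : Fin m → V) :
    α * (blockInner ip (matrixFunction R S v) (matrixFunction R S v)).re
      ≤ (blockPairing ip v (matrixFunction L S v)).re := by
  have hS := mem_ball_of_posDef_defectMatrix hρ (posDef_gramMatrix ip) hD
  have hmem : ∀ z ∈ S.charpoly.roots.toFinset, z ∈ Metric.closedBall c ρ := fun z hz =>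
    Metric.ball_subset_closedBall (hS z hz)
  -- `w` stays fixed while `z` runs over the circle, so `R(z)` enters linearly and the integrand has
  -- a Cauchy formula.
  set w := matrixFunction R S v with hw
  set G := gramMatrix ip with hG
  let gL : Fin m → AntiDual V →L[ℂ] ℂ := fun a =>
    ContinuousLinearMap.apply' ℂ (starRingEnd ℂ) (v a)
  let gR : Fin m → V →L[ℂ] ℂ := fun a => innerSL ℂ (w a)
  have haL : ∀ a b, AnalyticOnNhd ℂ (fun z => L z (v b) (v a)) (Metric.closedBall c ρ) :=
    fun a b => by
      have h := (gL a ∘L (ContinuousLinearMap.apply ℂ (AntiDual V) (v b) :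
        (V →L[ℂ] AntiDual V) →L[ℂ] AntiDual V)).comp_analyticOnNhd hL
      exact h
  have haR : ∀ a b, AnalyticOnNhd ℂ (fun z => inner ℂ (w a) (R z (v b)))
      (Metric.closedBall c ρ) :=
    fun a b => (gR a ∘L (ContinuousLinearMap.apply ℂ V (v b) :
      (V →L[ℂ] V) →L[ℂ] V)).comp_analyticOnNhd hR
  have ha1 : ∀ a b, AnalyticOnNhd ℂ (fun _ => inner ℂ (w a) (w b)) (Metric.closedBall c ρ) :=
    fun a b => analyticOnNhd_const
  have eL : Real.circleAverage (fun z => ∑ a, ∑ b, discKernel G S c ρ z a b * L z (v b) (v a)) c ρ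
      = blockPairing ip v (matrixFunction L S v) := by
    rw [circleAverage_sum_discKernel_mul hρ hS haL, blockPairing]
    refine Finset.sum_congr rfl fun a _ => Finset.sum_congr rfl fun e _ => ?_
    exact congrArg _ (clm_matrixFunction (fun z hz => hL z (hmem z hz)) (gL a) v e).symm
  have eR : Real.circleAverage (fun z => ∑ a, ∑ b, discKernel G S c ρ z a b *
      inner ℂ (w a) (R z (v b))) c ρ = blockInner ip w w := by
    rw [circleAverage_sum_discKernel_mul hρ hS haR, blockInner]
    refine Finset.sum_congr rfl fun a _ => Finset.sum_congr rfl fun e _ => ?_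
    exact congrArg _ (clm_matrixFunction (fun z hz => hR z (hmem z hz)) (gR a) v e).symm
  have e1 : Real.circleAverage (fun z => ∑ a, ∑ b, discKernel G S c ρ z a b *
      inner ℂ (w a) (w b)) c ρ = blockInner ip w w := by
    rw [circleAverage_sum_discKernel_mul hρ hS ha1, blockInner]
    refine Finset.sum_congr rfl fun a _ => Finset.sum_congr rfl fun e _ => ?_
    simp [matrixFunctionEntry_const, Matrix.one_apply, hG, gramMatrix]
  have iL : CircleIntegrable (fun z => ∑ a, ∑ b, discKernel G S c ρ z a b * L z (v b) (v a)) c ρ :=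
    CircleIntegrable.fun_sum _ fun a _ => CircleIntegrable.fun_sum _ fun b _ =>
      circleIntegrable_sum_discKernel_mul hρ hS haL a b
  have iR : CircleIntegrable (fun z => (2 * α : ℂ) • ∑ a, ∑ b, discKernel G S c ρ z a b *
      inner ℂ (w a) (R z (v b))) c ρ :=
    (CircleIntegrable.fun_sum _ fun a _ => CircleIntegrable.fun_sum _ fun b _ =>
      circleIntegrable_sum_discKernel_mul hρ hS haR a b).const_smul
  have i1 : CircleIntegrable (fun z => (α : ℂ) • ∑ a, ∑ b, discKernel G S c ρ z a b *
      inner ℂ (w a) (w b)) c ρ :=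
    (CircleIntegrable.fun_sum _ fun a _ => CircleIntegrable.fun_sum _ fun b _ =>
      circleIntegrable_sum_discKernel_mul hρ hS ha1 a b).const_smul
  -- The averages of the cross term and of the constant term both reproduce `blockInner ip w w`,
  -- with weights `-2α` and `α`.
  have hnonneg := Real.circleAverage_re_nonneg ((iL.sub iR).add i1) fun z hz => by
    rw [abs_of_pos hρ] at hz
    exact (hD.posSemidef.conjTranspose_mul_mul_same (Matrix.scalar (Fin m) z - S)⁻¹).coercivity hα
      (fun v => hpos v z (Metric.sphere_subset_closedBall hz)) v w
  rw [Real.circleAverage_add (iL.sub iR) i1, Real.circleAverage_sub iL iR,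
    Real.circleAverage_fun_smul, Real.circleAverage_fun_smul, eL, eR, e1] at hnonneg
  have h7 : (2 * (α : ℂ)) = ((2 * α : ℝ) : ℂ) := by push_cast; ring
  rw [h7, smul_eq_mul, smul_eq_mul, Complex.add_re, Complex.sub_re, Complex.re_ofReal_mul,
    Complex.re_ofReal_mul] at hnonneg
  linarith

/-! ### Boundary eigenvalues and the limit of vanishing shift -/

/-- Eigenvalues on the boundary of the half plane that contains the numerical range are
semisimple. -/
lemma sub_scalar_mul_spectralProjection_of_re_eq (ip : InnerProductSpace.Core ℂ (Fin m → ℂ))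
    {σ : ℝ} {S : Matrix (Fin m) (Fin m) ℂ}
    (hS : ∀ w : Fin m → ℂ, σ * (ip.inner w w).re ≤ (ip.inner w (S.mulVec w)).re) {z : ℂ}
    (hz : z.re = σ) : (S - Matrix.scalar (Fin m) z) * spectralProjection S z = 0 := by
  refine sub_scalar_mul_spectralProjection_of_semisimple S z fun w hw => ?_
  set N := S - Matrix.scalar (Fin m) z with hN
  have hre : ∀ x, 0 ≤ (ip.inner x (N.mulVec x)).re := by
    intro x
    have h1 : ip.inner x (N.mulVec x) = ip.inner x (S.mulVec x) - z * ip.inner x x := by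
      rw [hN, sub_scalar_mulVec]
      simp only [inner_eq_star_dotProduct_gramMatrix, Matrix.mulVec_sub, Matrix.mulVec_smul,
        dotProduct_sub, dotProduct_smul, smul_eq_mul]
    have him : (ip.inner x x).im = 0 := by
      rw [← Complex.conj_eq_iff_im]; exact ip.conj_inner_symm x x
    rw [h1, Complex.sub_re, Complex.mul_re, him, hz]
    linarith [hS x]
  set y := N.mulVec w with hy
  -- Since `N y = 0`, the vector `w + t y` is mapped to `y`. An affine function of `t` that is
  -- nonnegative on all of `ℝ` has slope zero, so `y = 0`.
  have hlin : ∀ t : ℝ, 0 ≤ (ip.inner w y).re + t * (ip.inner y y).re := by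
    intro t
    have h1 := hre (w + (t : ℂ) • y)
    rw [Matrix.mulVec_add, Matrix.mulVec_smul, hw, smul_zero, add_zero, ← hy, ip.add_left,
      ip.smul_left, Complex.conj_ofReal, Complex.add_re, Complex.re_ofReal_mul] at h1
    exact h1
  by_contra hne
  have hp := (posDef_gramMatrix ip).dotProduct_mulVec_pos hne
  rw [← inner_eq_star_dotProduct_gramMatrix, Complex.pos_iff] at hp
  have h2 := hlin (-((ip.inner w y).re + 1) / (ip.inner y y).re)
  rw [div_mul_cancel₀ _ hp.1.ne'] at h2
  linarith

lemma le_re_of_mem_charpoly_roots (ip : InnerProductSpace.Core ℂ (Fin m → ℂ))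
    {σ : ℝ} {S : Matrix (Fin m) (Fin m) ℂ}
    (hS : ∀ w : Fin m → ℂ, σ * (ip.inner w w).re ≤ (ip.inner w (S.mulVec w)).re) {z : ℂ}
    (hz : z ∈ S.charpoly.roots.toFinset) : σ ≤ z.re := by
  obtain ⟨w, hw⟩ := ((mem_charpoly_roots_toFinset S z).1 hz).exists_hasEigenvector
  have hSw : S.mulVec w = z • w := by simpa using hw.apply_eq_smul
  have h1 := hS w
  have hp := (posDef_gramMatrix ip).dotProduct_mulVec_pos hw.2
  have h2 : ip.inner w (z • w) = z * ip.inner w w := by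
    simp only [inner_eq_star_dotProduct_gramMatrix, Matrix.mulVec_smul, dotProduct_smul,
      smul_eq_mul]
  rw [← inner_eq_star_dotProduct_gramMatrix, Complex.pos_iff] at hp
  rw [hSw, h2, Complex.mul_re, ← hp.2, mul_zero, sub_zero] at h1
  exact le_of_mul_le_mul_right h1 hp.1

/-- Matrix functions depend continuously on translations of the function into the half plane. -/
lemma tendsto_matrixFunction_comp_add {E F : Type*} [NormedAddCommGroup E] [NormedSpace ℂ E]
    [NormedAddCommGroup F] [NormedSpace ℂ F] [CompleteSpace F]
    (ip : InnerProductSpace.Core ℂ (Fin m → ℂ)) {σ : ℝ} {S : Matrix (Fin m) (Fin m) ℂ}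
    (hS : ∀ w : Fin m → ℂ, σ * (ip.inner w w).re ≤ (ip.inner w (S.mulVec w)).re)
    {f : ℂ → E →L[ℂ] F} (hf : AnalyticOnNhd ℂ f {s | σ < s.re})
    (hfc : ContinuousOn f {s | σ ≤ s.re}) (v : Fin m → E) (e : Fin m) :
    Filter.Tendsto (fun ε : ℝ => matrixFunction (fun s => f (s + ε)) S v e) (𝓝[>] 0)
      (𝓝 (matrixFunction f S v e)) := by
  have hadd : ∀ z : ℂ, Filter.Tendsto (fun ε : ℝ => z + (ε : ℂ)) (𝓝[>] 0) (𝓝 z) := by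
    intro z
    have : Continuous fun ε : ℝ => z + (ε : ℂ) := by fun_prop
    have h := this.tendsto 0
    rw [Complex.ofReal_zero, add_zero] at h
    exact h.mono_left nhdsWithin_le_nhds
  simp only [matrixFunction]
  refine tendsto_finsetSum _ fun z hz => tendsto_finsetSum _ fun k _ => tendsto_finsetSum _
    fun j _ => ?_
  simp only [iteratedDeriv_comp_add_const]
  have hσ := le_re_of_mem_charpoly_roots ip hS hz
  rcases hσ.lt_or_eq with hlt | heq
  · have hc : ContinuousAt (iteratedDeriv k f) z := by
      rw [iteratedDeriv_eq_iterate]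
      exact ((hf z hlt).iterated_deriv k).continuousAt
    exact (((ContinuousLinearMap.apply ℂ F (v j)).continuous.tendsto _).comp
      (hc.tendsto.comp (hadd z))).const_smul _
  · rcases k with _ | k
    · simp only [iteratedDeriv_zero]
      -- At a boundary eigenvalue `f` is only continuous within the closed half plane; the shifted
      -- points approach from inside it.
      have hin : Filter.Tendsto (fun ε : ℝ => z + (ε : ℂ)) (𝓝[>] 0) (𝓝[{s | σ ≤ s.re}] z) := by
        refine tendsto_nhdsWithin_iff.2 ⟨hadd z, ?_⟩
        filter_upwards [self_mem_nhdsWithin] with ε hε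
        have hε' : 0 < ε := hε
        change σ ≤ (z + (ε : ℂ)).re
        rw [Complex.add_re, Complex.ofReal_re]
        linarith
      exact (((ContinuousLinearMap.apply ℂ F (v j)).continuous.tendsto _).comp
        ((hfc z heq.le).tendsto.comp hin)).const_smul _
    -- The coefficients of all derivatives vanish here, so the values of `iteratedDeriv` on the
    -- boundary line are irrelevant.
    · have h0 : (S - Matrix.scalar (Fin m) z) ^ (k + 1) * spectralProjection S z = 0 := by
        rw [pow_succ, mul_assoc, sub_scalar_mul_spectralProjection_of_re_eq ip hS heq.symm,
          mul_zero]
      simp only [h0, Matrix.zero_apply, mul_zero, zero_smul]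
      exact tendsto_const_nhds

end Coercivity

theorem mainTheorem2 {V : Type*} [NormedAddCommGroup V] [InnerProductSpace ℂ V] [CompleteSpace V]
    (m : ℕ) (ip : InnerProductSpace.Core ℂ (Fin m → ℂ)) (σ α M μ : ℝ) (hα : 0 ≤ α)
    (L : ℂ → V →L[ℂ] AntiDual V) (R : ℂ → V →L[ℂ] V)
    (hL_an : AnalyticOnNhd ℂ L {s | σ < s.re}) (hL_cont : ContinuousOn L {s | σ ≤ s.re})
    (hR_an : AnalyticOnNhd ℂ R {s | σ < s.re}) (hR_cont : ContinuousOn R {s | σ ≤ s.re})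
    (hL_bound : ∀ s : ℂ, σ < s.re → ‖L s‖ ≤ M * (1 + ‖s‖) ^ μ)
    (hR_bound : ∀ s : ℂ, σ < s.re → ‖R s‖ ≤ M * (1 + ‖s‖) ^ μ)
    (hpos : ∀ (v : V) (s : ℂ), σ ≤ s.re → α * ‖R s v‖ ^ 2 ≤ (L s v v).re)
    (S : Matrix (Fin m) (Fin m) ℂ)
    (hS : ∀ w : Fin m → ℂ, σ * (ip.inner w w).re ≤ (ip.inner w (S.mulVec w)).re)
    (v : Fin m → V) :
    α * blockNorm ip (matrixFunction R S v) ^ 2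
      ≤ (blockPairing ip v (matrixFunction L S v)).re := by
  rw [blockNorm, Real.sq_sqrt (blockInner_self_re_nonneg ip _)]
  have hstrict : ∀ᶠ ε : ℝ in 𝓝[>] 0,
      α * (blockInner ip (matrixFunction (fun s => R (s + ε)) S v)
        (matrixFunction (fun s => R (s + ε)) S v)).re
      ≤ (blockPairing ip v (matrixFunction (fun s => L (s + ε)) S v)).re := by
    filter_upwards [self_mem_nhdsWithin] with ε hε
    -- The disc may cross the line `Re s = σ`, but its translate by `ε` lies in the open half plane
    -- where `L` and `R` are analytic.
    obtain ⟨c, ρ, hρ, hsub, hD⟩ := exists_posDef_defectMatrix ip hε S hS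
    have hshift : ∀ s ∈ Metric.closedBall c ρ, σ < (s + (ε : ℂ)).re := by
      intro s hs
      have h := hsub hs
      rw [Set.mem_ofPred_eq] at h
      rw [Complex.add_re, Complex.ofReal_re]
      linarith
    have hadd : ∀ s : ℂ, AnalyticAt ℂ (fun s : ℂ => s + (ε : ℂ)) s := fun s =>
      analyticAt_id.add analyticAt_const
    exact coercivity_of_posDef_defectMatrix ip hα hρ
      (fun s hs => AnalyticAt.fun_comp (g := L) (hL_an (s + ε) (hshift s hs)) (hadd s))
      (fun s hs => AnalyticAt.fun_comp (g := R) (hR_an (s + ε) (hshift s hs)) (hadd s))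
      (fun v s hs => hpos v (s + ε) (hshift s hs).le) hD v
  refine le_of_tendsto_of_tendsto ?_ ?_ hstrict
  · refine ((Complex.continuous_re.tendsto _).comp ?_).const_mul α
    refine tendsto_finsetSum _ fun i _ => tendsto_finsetSum _ fun j _ => ?_
    exact ((tendsto_matrixFunction_comp_add ip hS hR_an hR_cont v i).inner
      (tendsto_matrixFunction_comp_add ip hS hR_an hR_cont v j)).const_mul _
  · refine (Complex.continuous_re.tendsto _).comp ?_
    refine tendsto_finsetSum _ fun i _ => tendsto_finsetSum _ fun j _ => ?_
    exact (((ContinuousLinearMap.apply' ℂ (starRingEnd ℂ) (v i)).continuous.tendsto _).comp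
      (tendsto_matrixFunction_comp_add ip hS hL_an hL_cont v j)).const_mul _
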